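/- Consider units $i=1,2,\dots$ with covariates $X_i$ in a measurable space $\mathcal X$, system states $S_i$ in a finite non-empty set $\mathcal S$, binary treatments $W_i\in\{0,1\}$ and real outcomes $Y_i$. Let $P_X$ be a probability distribution on $\mathcal X$, and let $P_Y(\cdot\mid x,s,w)$ (on $\mathbb R$) and $P_S(\cdot\mid s,w)$ (on $\mathcal S$) be probability kernels. A policy is a measurable function $\pi:\mathcal X\times\mathcal S\to[0,1]$. Under $\pi$, conditionally on the past and on $S_i$, one draws $X_i\sim P_X$, then $W_i=1$ with probability $\pi(X_i,S_i)$ and $W_i=0$ otherwise, then $Y_i\sim P_Y(\cdot\mid X_i,S_i,W_i)$; and the next state is drawn as $S_{i+1}\sim P_S(\cdot\mid S_i,W_i)$, depending on the past only through $(S_i,W_i)$. Assume that for every policy $\pi$ the state process $(S_i)$ is an irreducible and aperiodic Markov chain, and that the outcomes are uniformly bounded almost surely, i.e. there is a constant $B$ such that $P_Y([-B,B]\mid x,s,w)=1$ for all $s,w$ and $P_X$-almost every $x$. Let $\tau(x,s)=\int y\,P_Y(dy\mid x,s,1)-\int y\,P_Y(dy\mid x,s,0)$ be the conditional average direct effect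 (a mean that does not exist, which can happen only for $x$ in a $P_X$-null set, is read as $0$), and let $$\mu(\pi)=\lim_{n\to\infty}\mathbb E_\pi\Big[\frac1n\sum_{i=1}^nY_i\,\Big|\,S_1=s\Big].$$ For every policy $\pi$ this limit exists and is the same for all initial states $s$. A policy is called optimal if it maximizes $\mu$ over all policies. Then there are constants $c_s\in\mathbb R$ and $p_s\in[0,1]$, $s\in\mathcal S$, such that the policy $$\pi^*(x,s)=I(\tau(x,s)>c_s)+I(\tau(x,s)=c_s)\,p_s,\qquad x\in\mathcal X,\ s\in\mathcal S,$$ is optimal. Furthermore, if for $X\sim P_X$ the distribution of $\tau(X,s)$ is continuous (that is, $P_X(\tau(X,s)=t)=0$ for every $t\in\mathbb R$) for all $s\in\mathcal S$, then there are constants $c_s\in\mathbb R$, $s\in\mathcal S$, such that the policy $\pi^*(x,s)=I(\tau(x,s)>c_s)$ is optimal. -/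

import Mathlib

open MeasureTheory ProbabilityTheory Filter Topology

/-- The record of one unit: covariate `X`, state `S`, treatment `W` and outcome `Y`. -/
abbrev UnitRecord (𝒳 S : Type*) : Type _ := ((𝒳 × S) × Bool) × ℝ

/-- The data of a time-homogeneous Markov decision process with exogenous covariates: the law
`PX` of the covariates, the law `PY ((x, s), w)` of the outcome of a unit with covariate `x` that
arrives in state `s` and gets treatment `w`, and the law `PS (s, w)` of the next state. -/
structure ExogMDP (𝒳 S : Type*) [MeasurableSpace 𝒳] [MeasurableSpace S] where
  PX : Measure 𝒳
  PY : Kernel ((𝒳 × S) × Bool) ℝ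
  PS : Kernel (S × Bool) S
  probPX : IsProbabilityMeasure PX
  markovPY : IsMarkovKernel PY
  markovPS : IsMarkovKernel PS

/-- A (measurable) treatment assignment policy `π : 𝒳 × S → [0, 1]`. -/
structure TreatPolicy (𝒳 S : Type*) [MeasurableSpace 𝒳] [MeasurableSpace S] where
  prob : 𝒳 → S → ℝ
  measurable_prob : Measurable (Function.uncurry prob)
  prob_nonneg : ∀ x s, 0 ≤ prob x s
  prob_le_one : ∀ x s, prob x s ≤ 1

/-- Every state has period one: the greatest common divisor of the possible return times is `1`. -/
def Matrix.IsAperiodic {S : Type*} [Fintype S] [DecidableEq S] (A : Matrix S S ℝ) : Prop :=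
  ∀ s, ∀ d : ℕ, (∀ n : ℕ, 0 < (A ^ n) s s → d ∣ n) → d = 1

namespace TreatPolicy

variable {𝒳 S : Type*} [MeasurableSpace 𝒳] [MeasurableSpace S]

/-- The conditional law of `W` given `(X, S) = (x, s)`: `W = 1` with probability `π(x, s)`. -/
noncomputable def treatKernel (π : TreatPolicy 𝒳 S) : Kernel (𝒳 × S) Bool where
  toFun z := ENNReal.ofReal (π.prob z.1 z.2) • Measure.dirac true
    + ENNReal.ofReal (1 - π.prob z.1 z.2) • Measure.dirac false
  measurable' := by
    have h : Measurable fun z : 𝒳 × S => π.prob z.1 z.2 := π.measurable_prob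
    refine Measure.measurable_of_measurable_coe _ fun t _ => ?_
    simp only [Measure.add_apply, Measure.smul_apply, smul_eq_mul]
    exact (h.ennreal_ofReal.mul_const _).add ((h.const_sub 1).ennreal_ofReal.mul_const _)

instance (π : TreatPolicy 𝒳 S) : IsMarkovKernel π.treatKernel where
  isProbabilityMeasure z := ⟨by
    have h0 := π.prob_nonneg z.1 z.2
    have h1 := π.prob_le_one z.1 z.2
    simp only [treatKernel, Kernel.coe_mk, Measure.add_apply, Measure.smul_apply, smul_eq_mul,
      measure_univ, mul_one]
    rw [← ENNReal.ofReal_add h0 (by linarith)]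
    simp⟩

end TreatPolicy

namespace ExogMDP

variable {𝒳 S : Type*} [MeasurableSpace 𝒳] [Fintype S] [DecidableEq S] [MeasurableSpace S]
  [MeasurableSingletonClass S]

instance (M : ExogMDP 𝒳 S) : IsProbabilityMeasure M.PX := M.probPX
instance (M : ExogMDP 𝒳 S) : IsMarkovKernel M.PY := M.markovPY
instance (M : ExogMDP 𝒳 S) : IsMarkovKernel M.PS := M.markovPS

/-- The law of the record of a unit that arrives in state `s`, under the policy `π`: `X ∼ PX`,
then `W` is drawn according to `π(X, s)`, then `Y ∼ PY ((X, s), W)`. -/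
noncomputable def unitLaw (M : ExogMDP 𝒳 S) (π : TreatPolicy 𝒳 S) (s : S) :
    Measure (UnitRecord 𝒳 S) :=
  ((M.PX.prod (Measure.dirac s)) ⊗ₘ π.treatKernel) ⊗ₘ M.PY

instance (M : ExogMDP 𝒳 S) (π : TreatPolicy 𝒳 S) (s : S) :
    IsProbabilityMeasure (M.unitLaw π s) := by
  unfold unitLaw; infer_instance

noncomputable def unitKernel (M : ExogMDP 𝒳 S) (π : TreatPolicy 𝒳 S) :
    Kernel S (UnitRecord 𝒳 S) :=
  Kernel.ofFunOfCountable (M.unitLaw π)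

instance (M : ExogMDP 𝒳 S) (π : TreatPolicy 𝒳 S) : IsMarkovKernel (M.unitKernel π) :=
  ⟨fun s => inferInstanceAs (IsProbabilityMeasure (M.unitLaw π s))⟩

/-- From the record of unit `i` to the record of unit `i + 1`: the next state is drawn from
`PS (s, w)`, then the next unit's record from its law given that state. -/
noncomputable def stepKernel (M : ExogMDP 𝒳 S) (π : TreatPolicy 𝒳 S) :
    Kernel (UnitRecord 𝒳 S) (UnitRecord 𝒳 S) :=
  M.unitKernel π ∘ₖ M.PS.comap (fun z : UnitRecord 𝒳 S => (z.1.1.2, z.1.2)) (by fun_prop)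

instance (M : ExogMDP 𝒳 S) (π : TreatPolicy 𝒳 S) : IsMarkovKernel (M.stepKernel π) := by
  unfold stepKernel; infer_instance

/-- The conditional law of the record of unit `i + 1` given the records of all units up to `i`. -/
noncomputable def historyKernel (M : ExogMDP 𝒳 S) (π : TreatPolicy 𝒳 S) (i : ℕ) :
    Kernel (Finset.Iic i → UnitRecord 𝒳 S) (UnitRecord 𝒳 S) :=
  (M.stepKernel π).comap (fun h => h ⟨i, Finset.mem_Iic.2 le_rfl⟩) (measurable_pi_apply _)

instance (M : ExogMDP 𝒳 S) (π : TreatPolicy 𝒳 S) (i : ℕ) :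
    IsMarkovKernel (M.historyKernel π i) := by
  unfold historyKernel; infer_instance

/-- The law, under the policy `π` and with first state `s`, of the whole sequence of unit records
(units are numbered from `0`). -/
noncomputable def processLaw (M : ExogMDP 𝒳 S) (π : TreatPolicy 𝒳 S) (s : S) :
    Measure (ℕ → UnitRecord 𝒳 S) :=
  Kernel.trajMeasure (X := fun _ => UnitRecord 𝒳 S) (M.unitLaw π s) (M.historyKernel π)

/-- The outcome of the `i`-th unit. -/
def outcome (i : ℕ) (ω : ℕ → UnitRecord 𝒳 S) : ℝ := (ω i).2

/-- The expected average outcome of the first `n` units, given that the first state is `s`. -/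
noncomputable def expectedAverage (M : ExogMDP 𝒳 S) (π : TreatPolicy 𝒳 S) (s : S) (n : ℕ) : ℝ :=
  ∫ ω, (1 / (n : ℝ)) * ∑ i ∈ Finset.range n, outcome i ω ∂(M.processLaw π s)

/-- `v` is the long-run average outcome `μ(π)` of the policy `π`: the expected average outcomes
converge to `v`, whatever the first state. -/
def HasLongRunAverage (M : ExogMDP 𝒳 S) (π : TreatPolicy 𝒳 S) (v : ℝ) : Prop :=
  ∀ s, Tendsto (M.expectedAverage π s) atTop (𝓝 v)

/-- `π` maximizes the long-run average outcome over all policies; the long-run average of every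
policy is required to exist. -/
def IsOptimal (M : ExogMDP 𝒳 S) (π : TreatPolicy 𝒳 S) : Prop :=
  ∃ v, M.HasLongRunAverage π v ∧
    ∀ π' : TreatPolicy 𝒳 S, ∃ v', M.HasLongRunAverage π' v' ∧ v' ≤ v

/-- The transition matrix of the state process `S_1, S_2, …` under the policy `π`. -/
noncomputable def stateMatrix (M : ExogMDP 𝒳 S) (π : TreatPolicy 𝒳 S) : Matrix S S ℝ :=
  fun s s' => ∫ x, (π.prob x s * (M.PS (s, true)).real {s'}
    + (1 - π.prob x s) * (M.PS (s, false)).real {s'}) ∂M.PX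

/-- Under every policy, the state process is irreducible and aperiodic. -/
def IsStable (M : ExogMDP 𝒳 S) : Prop :=
  ∀ π : TreatPolicy 𝒳 S, (M.stateMatrix π).IsIrreducible ∧ (M.stateMatrix π).IsAperiodic

/-- The outcomes are almost surely bounded by one constant. -/
def BoundedOutcomes (M : ExogMDP 𝒳 S) : Prop :=
  ∃ B : ℝ, ∀ s w, ∀ᵐ x ∂M.PX, ∀ᵐ y ∂M.PY ((x, s), w), |y| ≤ B

/-- The conditional average direct effect
`τ(x, s) = E[Y | X = x, S = s, W = 1] - E[Y | X = x, S = s, W = 0]`. -/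
noncomputable def cade (M : ExogMDP 𝒳 S) (x : 𝒳) (s : S) : ℝ :=
  (∫ y, y ∂M.PY ((x, s), true)) - ∫ y, y ∂M.PY ((x, s), false)

end ExogMDP

/-! The argument is policy improvement started from an optimum over a compactified set of policies.
The covariates are fresh at each step, so a policy π enters the long-run average only through two
vectors indexed by the finite state space: the treatment probabilities e(s) = E π(X, s), which
determine the transition matrix P, and the expected rewards r(s) (`map_eval_processLaw`,
`BoundedOutcomes.expectedAverage_eq`).

If g + h = r + P h, telescoping shows that the average outcome converges to g. Irreducibility makes
this Poisson equation uniquely solvable under the normalization g = h(s₀), and the solution is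
continuous in (e, r). Hence g attains a maximum on the compact closure of the achievable pairs (e,
r), perhaps at a pair that no policy realizes.

For the h of that maximizer, maximizing r + P h over policies is a pointwise problem in x: treat
when τ(x, s) exceeds a constant c(s), the loss in expected continuation value caused by treating.
The resulting threshold policy dominates the maximizing pair in the Poisson equation, so a minimum
principle for the difference of the two solutions shows that its gain is at least the maximum. -/

set_option linter.unusedSectionVars false

/-! ### One-dimensional marginals of a trajectory measure. -/

section Kernel

variable {E : Type*} [MeasurableSpace E] (μ₀ : Measure E) [IsProbabilityMeasure μ₀]

theorem map_eval_zero_trajMeasure (κ : (n : ℕ) → Kernel (Finset.Iic n → E) E)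
    [∀ n, IsMarkovKernel (κ n)] :
    (Kernel.trajMeasure (X := fun _ => E) μ₀ κ).map (fun x => x 0) = μ₀ := by
  have h : (fun x : ℕ → E => x 0) =
      (fun y : Finset.Iic 0 → E => y ⟨0, by simp⟩) ∘ Preorder.frestrictLe 0 := rfl
  have hm : Measurable (MeasurableEquiv.piUnique (fun _ : Finset.Iic 0 => E)).symm :=
    MeasurableEquiv.measurable _
  rw [h, ← Measure.map_map (by fun_prop) (by fun_prop), Kernel.trajMeasure,
    Measure.map_comp _ _ (by fun_prop), Kernel.traj_map_frestrictLe, Kernel.partialTraj_self]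
  erw [Measure.id_comp, Measure.map_map (by fun_prop) hm]
  exact Measure.map_id

/-- The conditional law of the next coordinate reads only the last one, so projecting the joint law
of history and next coordinate gives a Markov recursion for the marginals. -/
theorem map_eval_succ_trajMeasure (K : Kernel E E) [IsMarkovKernel K] (i : ℕ) :
    (Kernel.trajMeasure (X := fun _ => E) μ₀
      (fun n => K.comap (fun h : Finset.Iic n → E => h ⟨n, Finset.mem_Iic.2 le_rfl⟩)
        (measurable_pi_apply _))).map (fun x => x (i + 1)) =
    K ∘ₘ (Kernel.trajMeasure (X := fun _ => E) μ₀
      (fun n => K.comap (fun h : Finset.Iic n → E => h ⟨n, Finset.mem_Iic.2 le_rfl⟩)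
        (measurable_pi_apply _))).map (fun x => x i) := by
  set κ : (n : ℕ) → Kernel (Finset.Iic n → E) E := fun n =>
    K.comap (fun h : Finset.Iic n → E => h ⟨n, Finset.mem_Iic.2 le_rfl⟩) (measurable_pi_apply _)
    with hκ
  have key := Kernel.map_frestrictLe_trajMeasure_compProd_eq_map_trajMeasure
    (X := fun _ => E) (κ := κ) (μ₀ := μ₀) (a := i)
  have key' := congrArg (fun ν => ν.map Prod.snd) key
  rw [Measure.map_map (by fun_prop) (by fun_prop)] at key'
  erw [← Measure.snd, Measure.snd_compProd] at key'
  refine key'.symm.trans ?_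
  have h : (fun x : ℕ → E => x i) =
      (fun y : Finset.Iic i → E => y ⟨i, by simp⟩) ∘ Preorder.frestrictLe i := rfl
  rw [h, ← Measure.map_map (by fun_prop) (by fun_prop)]
  ext t ht
  rw [Measure.bind_apply ht (by fun_prop), Measure.bind_apply ht (by fun_prop),
    lintegral_map (K.measurable_coe ht) (by fun_prop)]
  rfl

end Kernel

/-! ### Integration against the law of one unit. -/

namespace ExogMDP

variable {𝒳 S : Type*} [MeasurableSpace 𝒳] [Fintype S] [DecidableEq S] [MeasurableSpace S]
  [MeasurableSingletonClass S] (M : ExogMDP 𝒳 S) (π : TreatPolicy 𝒳 S)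

theorem integral_treatKernel (f : Bool → ℝ) (z : 𝒳 × S) :
    ∫ w, f w ∂π.treatKernel z = π.prob z.1 z.2 * f true + (1 - π.prob z.1 z.2) * f false := by
  have h0 := π.prob_nonneg z.1 z.2
  have h1 := π.prob_le_one z.1 z.2
  simp only [TreatPolicy.treatKernel, Kernel.coe_mk]
  rw [integral_add_measure (Integrable.of_finite.smul_measure (by simp))
    (Integrable.of_finite.smul_measure (by simp)), integral_smul_measure, integral_smul_measure,
    integral_dirac, integral_dirac, ENNReal.toReal_ofReal h0, ENNReal.toReal_ofReal (by linarith)]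
  simp

theorem integral_unitLaw {f : UnitRecord 𝒳 S → ℝ} {s : S} (hm : Measurable f)
    (hf : Integrable f (M.unitLaw π s)) :
    ∫ r, f r ∂M.unitLaw π s =
      ∫ x, (π.prob x s * ∫ y, f (((x, s), true), y) ∂M.PY ((x, s), true)) +
        (1 - π.prob x s) * ∫ y, f (((x, s), false), y) ∂M.PY ((x, s), false) ∂M.PX := by
  have h1 : StronglyMeasurable fun z => ∫ y, f (z, y) ∂M.PY z :=
    hm.stronglyMeasurable.integral_kernel_prod_right'
  have h2 : StronglyMeasurable fun z => ∫ w, ∫ y, f ((z, w), y) ∂M.PY (z, w) ∂π.treatKernel z :=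
    h1.integral_kernel_prod_right'
  unfold unitLaw at hf ⊢
  rw [Measure.integral_compProd hf, Measure.integral_compProd (f := fun z => ∫ y, f (z, y) ∂M.PY z) 
      (Integrable.integral_compProd hf),
    Measure.prod_dirac, integral_map_of_stronglyMeasurable (by fun_prop) h2]
  simp_rw [integral_treatKernel π]

theorem ae_unitLaw {p : UnitRecord 𝒳 S → Prop} (hp : MeasurableSet {r | p r}) {s : S}
    (h : ∀ w, ∀ᵐ x ∂M.PX, ∀ᵐ y ∂M.PY ((x, s), w), p (((x, s), w), y)) :
    ∀ᵐ r ∂M.unitLaw π s, p r := by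
  have h1 : MeasurableSet {z | ∀ᵐ y ∂M.PY z, p (z, y)} :=
    (Kernel.measurable_kernel_prodMk_left (κ := M.PY) hp.compl) (measurableSet_singleton 0)
  have h2 : MeasurableSet {z | ∀ᵐ w ∂π.treatKernel z, ∀ᵐ y ∂M.PY (z, w), p ((z, w), y)} :=
    (Kernel.measurable_kernel_prodMk_left (κ := π.treatKernel) h1.compl)
      (measurableSet_singleton 0)
  unfold unitLaw
  rw [Measure.ae_compProd_iff hp, Measure.ae_compProd_iff h1, Measure.prod_dirac,
    ae_map_iff (by fun_prop) h2]
  filter_upwards [h true, h false] with x hx hx'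
  exact Eventually.of_forall fun w => by cases w <;> assumption

end ExogMDP

/-! ### Stochastic matrices and the Poisson equation. -/

section Stochastic

open Matrix

variable {S : Type*} [Fintype S] [DecidableEq S] {P : Matrix S S ℝ}

theorem mulVec_le_of_mem_rowStochastic (hP : P ∈ rowStochastic ℝ S) {h : S → ℝ} {c : ℝ}
    (hc : ∀ j, h j ≤ c) (s : S) : (P *ᵥ h) s ≤ c := by
  calc (P *ᵥ h) s = ∑ j, P s j * h j := rfl
    _ ≤ ∑ j, P s j * c :=
      Finset.sum_le_sum fun j _ => mul_le_mul_of_nonneg_left (hc j) (nonneg_of_mem_rowStochastic hP)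
    _ = c := by rw [← Finset.sum_mul, sum_row_of_mem_rowStochastic hP, one_mul]

theorem le_mulVec_of_mem_rowStochastic (hP : P ∈ rowStochastic ℝ S) {h : S → ℝ} {c : ℝ}
    (hc : ∀ j, c ≤ h j) (s : S) : c ≤ (P *ᵥ h) s := by
  have := mulVec_le_of_mem_rowStochastic hP (h := -h) (c := -c) (fun j => neg_le_neg (hc j)) s
  rw [mulVec_neg] at this
  exact neg_le_neg_iff.1 this

/-- Maximum principle: at a maximizer `m`, h(m) is a `P ^ k`-average of values that are at most
h(m), so h(j) = h(m) whenever `(P ^ k) m j > 0`. Irreducibility supplies such a `k` for each `j`. -/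
theorem eq_of_harmonic (hP : P ∈ rowStochastic ℝ S) (hirr : P.IsIrreducible) {h : S → ℝ}
    (hh : P *ᵥ h = h) (s t : S) : h s = h t := by
  have : Nonempty S := ⟨s⟩
  obtain ⟨m, hm⟩ := Finite.exists_max h
  have key : ∀ j, h j = h m := by
    intro j
    obtain ⟨k, -, hk⟩ :=
      (isIrreducible_iff_exists_pow_pos fun i j => nonneg_of_mem_rowStochastic hP).1 hirr m j
    have hPk : P ^ k ∈ rowStochastic ℝ S := pow_mem hP k
    have hhk : (P ^ k) *ᵥ h = h := by
      clear hk hPk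
      induction k with
      | zero => simp
      | succ k ih => rw [pow_succ, ← mulVec_mulVec, hh, ih]
    have h0 : ∑ i, (P ^ k) m i * (h m - h i) = 0 := by
      simp_rw [mul_sub]
      rw [Finset.sum_sub_distrib, ← Finset.sum_mul, sum_row_of_mem_rowStochastic hPk, one_mul,
        sub_eq_zero]
      exact (congrFun hhk m).symm
    have h1 := (Finset.sum_eq_zero_iff_of_nonneg fun i _ =>
      mul_nonneg (nonneg_of_mem_rowStochastic hPk) (sub_nonneg.2 (hm i))).1 h0 j (Finset.mem_univ j)
    rcases mul_eq_zero.1 h1 with h2 | h2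
    · exact absurd h2 hk.ne'
    · linarith
  rw [key s, key t]

/-- The matrix of the Poisson equation `h s₀ + h = r + P h` with normalization at `s₀`. -/
def poissonMatrix (s₀ : S) (P : Matrix S S ℝ) : Matrix S S ℝ :=
  1 - P + Matrix.of fun _ j => if j = s₀ then 1 else 0

theorem poissonMatrix_mulVec (s₀ : S) (P : Matrix S S ℝ) (h : S → ℝ) (s : S) :
    (poissonMatrix s₀ P *ᵥ h) s = h s - (P *ᵥ h) s + h s₀ := by
  rw [poissonMatrix, add_mulVec, sub_mulVec, one_mulVec, Pi.add_apply, Pi.sub_apply]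
  simp [mulVec, dotProduct]

theorem continuous_poissonMatrix (s₀ : S) : Continuous (poissonMatrix s₀) := by
  unfold poissonMatrix; fun_prop

/-- A kernel vector satisfies h - P h = -h(s₀). Comparing at its maximum and its minimum forces
h(s₀) = 0, so h is harmonic, hence constant, hence zero. -/
theorem isUnit_det_poissonMatrix (s₀ : S) (hP : P ∈ rowStochastic ℝ S) (hirr : P.IsIrreducible) :
    IsUnit (poissonMatrix s₀ P).det := by
  rw [isUnit_iff_ne_zero]
  intro h0
  obtain ⟨h, hne, hh⟩ := exists_mulVec_eq_zero_iff.2 h0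
  apply hne
  have hh' : ∀ s, h s - (P *ᵥ h) s + h s₀ = 0 := fun s => by
    rw [← poissonMatrix_mulVec, hh]; rfl
  have : Nonempty S := ⟨s₀⟩
  obtain ⟨m, hm⟩ := Finite.exists_max h
  obtain ⟨l, hl⟩ := Finite.exists_min h
  have hs₀ : h s₀ = 0 := by
    have h1 := mulVec_le_of_mem_rowStochastic hP hm m
    have h2 := le_mulVec_of_mem_rowStochastic hP hl l
    linarith [hh' m, hh' l]
  ext s
  rw [eq_of_harmonic hP hirr (h := h) (funext fun s => by linarith [hh' s]) s s₀, hs₀,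
    Pi.zero_apply]

/-- Substituting r = g + h - P h makes the sum telescope to n g + h - Pⁿ h, and the last two terms
stay bounded in n. -/
theorem tendsto_average_of_poisson (hP : P ∈ rowStochastic ℝ S) {r h : S → ℝ} {g : ℝ}
    (hg : ∀ s, g + h s = r s + (P *ᵥ h) s) (s : S) :
    Tendsto (fun n : ℕ => (1 / (n : ℝ)) * ∑ i ∈ Finset.range n, ((P ^ i) *ᵥ r) s)
      atTop (𝓝 g) := by
  have : Nonempty S := ⟨s⟩
  have hr : r = (fun _ => g) + h - P *ᵥ h := funext fun s => by
    simp only [Pi.sub_apply, Pi.add_apply]; linarith [hg s]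
  have hstep : ∀ i, ((P ^ i) *ᵥ r) s = g + (((P ^ i) *ᵥ h) s - ((P ^ (i + 1)) *ᵥ h) s) := by
    intro i
    have hc : ((P ^ i) *ᵥ fun _ => g) s = g := by
      have hPi : P ^ i ∈ rowStochastic ℝ S := pow_mem hP i
      exact le_antisymm (mulVec_le_of_mem_rowStochastic hPi (fun _ => le_rfl) s)
        (le_mulVec_of_mem_rowStochastic hPi (fun _ => le_rfl) s)
    rw [hr, mulVec_sub, mulVec_add, mulVec_mulVec, ← pow_succ]
    simp only [Pi.sub_apply, Pi.add_apply, hc]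
    ring
  have hsum : ∀ n, ∑ i ∈ Finset.range n, ((P ^ i) *ᵥ r) s
      = n * g + (h s - ((P ^ n) *ᵥ h) s) := by
    intro n
    simp_rw [hstep]
    rw [Finset.sum_add_distrib, Finset.sum_range_sub' (fun i => ((P ^ i) *ᵥ h) s)]
    simp
  obtain ⟨m, hm⟩ := Finite.exists_max h
  obtain ⟨l, hl⟩ := Finite.exists_min h
  have hlim : Tendsto (fun n : ℕ => (1 / (n : ℝ)) * (h s - ((P ^ n) *ᵥ h) s)) atTop (𝓝 0) := by
    refine tendsto_one_div_atTop_nhds_zero_nat.zero_mul_isBoundedUnder_le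
      (isBoundedUnder_of ⟨h m - h l, fun n => ?_⟩)
    have hPn : P ^ n ∈ rowStochastic ℝ S := pow_mem hP n
    simp only [Function.comp_apply, Real.norm_eq_abs, abs_le]
    constructor <;> linarith [hm s, hl s, mulVec_le_of_mem_rowStochastic hPn hm s,
      le_mulVec_of_mem_rowStochastic hPn hl s]
  have := hlim.const_add g
  rw [add_zero] at this
  refine this.congr' ?_
  filter_upwards [eventually_ne_atTop 0] with n hn
  rw [hsum]
  field_simp

end Stochastic

/-! ### Reduction of the process to a finite Markov chain with rewards. -/

namespace ExogMDP

open Matrix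

variable {𝒳 S : Type*} [MeasurableSpace 𝒳] [Fintype S] [DecidableEq S] [MeasurableSpace S]
  [MeasurableSingletonClass S] (M : ExogMDP 𝒳 S) (π : TreatPolicy 𝒳 S)

theorem integrable_prob (s : S) : Integrable (fun x => π.prob x s) M.PX := by
  have hm : Measurable fun x => π.prob x s := π.measurable_prob.of_uncurry_right
  refine Integrable.of_bound hm.aestronglyMeasurable 1 (Eventually.of_forall fun x => ?_)
  rw [Real.norm_eq_abs, abs_of_nonneg (π.prob_nonneg x s)]
  exact π.prob_le_one x s

/-- The transition matrix of the state process when the treatment probability in state `s`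
is `e s`. -/
noncomputable def mixMatrix (e : S → ℝ) : Matrix S S ℝ :=
  fun s s' => e s * (M.PS (s, true)).real {s'} + (1 - e s) * (M.PS (s, false)).real {s'}

theorem stateMatrix_eq_mixMatrix :
    M.stateMatrix π = M.mixMatrix fun s => ∫ x, π.prob x s ∂M.PX := by
  ext s s'
  have hi := M.integrable_prob π s
  unfold stateMatrix mixMatrix
  have hi' : Integrable (fun x => 1 - π.prob x s) M.PX := (integrable_const 1).sub hi
  rw [integral_add (hi.mul_const _) (hi'.mul_const _), integral_mul_const, integral_mul_const,
    integral_sub (integrable_const 1) hi]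
  simp

theorem mixMatrix_mem_rowStochastic {e : S → ℝ} (he : ∀ s, e s ∈ Set.Icc (0 : ℝ) 1) :
    M.mixMatrix e ∈ rowStochastic ℝ S := by
  rw [mem_rowStochastic_iff_sum]
  refine ⟨fun s s' => add_nonneg (mul_nonneg (he s).1 measureReal_nonneg)
    (mul_nonneg (sub_nonneg.2 (he s).2) measureReal_nonneg), fun s => ?_⟩
  have h (w : Bool) : ∑ s', (M.PS (s, w)).real {s'} = 1 := by
    rw [sum_measureReal_singleton]; simp
  simp only [mixMatrix]
  rw [Finset.sum_add_distrib, ← Finset.mul_sum, ← Finset.mul_sum, h, h]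
  ring

theorem integral_prob_mem_Icc (s : S) : ∫ x, π.prob x s ∂M.PX ∈ Set.Icc (0 : ℝ) 1 := by
  refine ⟨integral_nonneg fun x => π.prob_nonneg x s, ?_⟩
  calc ∫ x, π.prob x s ∂M.PX ≤ ∫ _, (1 : ℝ) ∂M.PX :=
      integral_mono (M.integrable_prob π s) (integrable_const _) fun x => π.prob_le_one x s
    _ = 1 := by simp

theorem stateMatrix_mem_rowStochastic : M.stateMatrix π ∈ rowStochastic ℝ S := by
  rw [stateMatrix_eq_mixMatrix]
  exact M.mixMatrix_mem_rowStochastic (M.integral_prob_mem_Icc π)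

theorem IsStable.isIrreducible_mixMatrix {M : ExogMDP 𝒳 S} (hM : M.IsStable) {e : S → ℝ}
    (he : ∀ s, e s ∈ Set.Icc (0 : ℝ) 1) : (M.mixMatrix e).IsIrreducible := by
  -- Every vector of treatment probabilities comes from a policy that ignores the covariate, so
  -- stability applies to it.
  have := (hM ⟨fun _ s => e s, (measurable_of_finite e).comp measurable_snd, fun _ s => (he s).1,
    fun _ s => (he s).2⟩).1
  rw [stateMatrix_eq_mixMatrix] at this
  simpa using this

theorem continuous_mixMatrix : Continuous M.mixMatrix := by
  unfold mixMatrix; fun_prop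

/-- The mean outcome of a unit with covariate `x` in state `s` that gets treatment `w`. -/
noncomputable def meanOutcome (x : 𝒳) (s : S) (w : Bool) : ℝ := ∫ y, y ∂M.PY ((x, s), w)

/-- The expected outcome of a unit that arrives in state `s`, under the policy `π`. -/
noncomputable def reward (s : S) : ℝ :=
  ∫ x, (π.prob x s * M.meanOutcome x s true + (1 - π.prob x s) * M.meanOutcome x s false) ∂M.PX

theorem measurable_meanOutcome (s : S) (w : Bool) : Measurable fun x => M.meanOutcome x s w := by
  have h : StronglyMeasurable fun z => ∫ y, y ∂M.PY z :=
    stronglyMeasurable_id.integral_kernel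
  exact h.measurable.comp (g := fun z => ∫ y, y ∂M.PY z) (f := fun x => ((x, s), w)) (by fun_prop)

/-- Integrating out the covariate, treatment and outcome leaves row `s` of the state matrix as the
law of the next state, and the next record depends on the past only through that state. -/
theorem comp_stepKernel_unitLaw (s : S) :
    M.stepKernel π ∘ₘ M.unitLaw π s =
      ∑ s', ENNReal.ofReal (M.stateMatrix π s s') • M.unitLaw π s' := by
  have hm (s' : S) : Measurable fun z : UnitRecord 𝒳 S => (M.PS (z.1.1.2, z.1.2)).real {s'} :=
    ((M.PS.measurable_coe (measurableSet_singleton s')).comp (by fun_prop)).ennreal_toReal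
  set κ : Kernel (UnitRecord 𝒳 S) S :=
    M.PS.comap (fun z : UnitRecord 𝒳 S => (z.1.1.2, z.1.2)) (by fun_prop) with hκ
  have hν (s' : S) : (κ ∘ₘ M.unitLaw π s) {s'} = ENNReal.ofReal (M.stateMatrix π s s') := by
    have hi : Integrable (fun z : UnitRecord 𝒳 S => (M.PS (z.1.1.2, z.1.2)).real {s'})
        (M.unitLaw π s) :=
      Integrable.of_bound (hm s').aestronglyMeasurable 1 (Eventually.of_forall fun z => by
        rw [Real.norm_eq_abs, abs_of_nonneg measureReal_nonneg]; exact measureReal_le_one)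
    have h1 := M.integral_unitLaw π (hm s') hi
    simp only [integral_const, probReal_univ, one_smul] at h1
    rw [stateMatrix, ← h1, ofReal_integral_eq_lintegral_ofReal hi
      (Eventually.of_forall fun _ => measureReal_nonneg),
      Measure.bind_apply (measurableSet_singleton s') (by fun_prop)]
    refine lintegral_congr fun z => ?_
    rw [ofReal_measureReal]
    rfl
  unfold stepKernel
  rw [← Measure.comp_assoc]
  ext t ht
  rw [Measure.bind_apply ht (by fun_prop), lintegral_fintype, Measure.finsetSum_apply]
  refine Finset.sum_congr rfl fun s' _ => ?_
  rw [hν, mul_comm]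
  rfl

theorem map_eval_processLaw (s : S) (i : ℕ) :
    (M.processLaw π s).map (fun ω => ω i) =
      ∑ s', ENNReal.ofReal ((M.stateMatrix π ^ i) s s') • M.unitLaw π s' := by
  have hP := M.stateMatrix_mem_rowStochastic π
  induction i with
  | zero =>
    refine (map_eval_zero_trajMeasure _ _).trans ?_
    rw [Finset.sum_eq_single s (fun t _ ht => by simp [Matrix.one_apply_ne' ht])
      (fun h => absurd (Finset.mem_univ s) h)]
    simp
  | succ i ih =>
    have h := map_eval_succ_trajMeasure (M.unitLaw π s) (M.stepKernel π) i
    refine h.trans ?_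
    change M.stepKernel π ∘ₘ (M.processLaw π s).map (fun ω => ω i) = _
    have hPi : M.stateMatrix π ^ i ∈ rowStochastic ℝ S := pow_mem hP i
    rw [ih]
    ext t ht
    have hb (μ : Measure (UnitRecord 𝒳 S)) :
        (M.stepKernel π ∘ₘ μ) t = ∫⁻ z, M.stepKernel π z t ∂μ :=
      Measure.bind_apply ht (by fun_prop)
    rw [hb, lintegral_finsetSum_measure]
    simp_rw [lintegral_smul_measure, ← hb, comp_stepKernel_unitLaw, Measure.finsetSum_apply,
      Measure.smul_apply, smul_eq_mul, Finset.mul_sum, ← mul_assoc]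
    rw [Finset.sum_comm]
    refine Finset.sum_congr rfl fun s' _ => ?_
    rw [← Finset.sum_mul, pow_succ, Matrix.mul_apply, ENNReal.ofReal_sum_of_nonneg fun j _ =>
      mul_nonneg (nonneg_of_mem_rowStochastic hPi) (nonneg_of_mem_rowStochastic hP)]
    simp_rw [ENNReal.ofReal_mul (nonneg_of_mem_rowStochastic hPi)]

variable {M} in
theorem BoundedOutcomes.integrable_unitLaw (hM : M.BoundedOutcomes) (s : S) :
    Integrable (fun r : UnitRecord 𝒳 S => r.2) (M.unitLaw π s) := by
  obtain ⟨B, hB⟩ := hM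
  refine Integrable.of_bound measurable_snd.aestronglyMeasurable B ?_
  exact M.ae_unitLaw π (measurableSet_le measurable_snd.abs measurable_const) fun w => hB s w

variable {M} in
theorem BoundedOutcomes.exists_bound_meanOutcome (hM : M.BoundedOutcomes) :
    ∃ B : ℝ, ∀ s w, ∀ᵐ x ∂M.PX, |M.meanOutcome x s w| ≤ B := by
  obtain ⟨B, hB⟩ := hM
  refine ⟨B, fun s w => (hB s w).mono fun x hx => ?_⟩
  simpa [meanOutcome] using norm_integral_le_of_norm_le_const (f := fun y : ℝ => y) hx

variable {M} in
theorem BoundedOutcomes.integrable_meanOutcome (hM : M.BoundedOutcomes) (s : S) (w : Bool) :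
    Integrable (fun x => M.meanOutcome x s w) M.PX := by
  obtain ⟨B, hB⟩ := hM.exists_bound_meanOutcome
  exact Integrable.of_bound (M.measurable_meanOutcome s w).aestronglyMeasurable B (hB s w)

variable {M} in
theorem BoundedOutcomes.integrable_prob_mul_add (hM : M.BoundedOutcomes) (s : S) (a b : ℝ) :
    Integrable (fun x => π.prob x s * (M.meanOutcome x s true + a)
      + (1 - π.prob x s) * (M.meanOutcome x s false + b)) M.PX := by
  have hm : Measurable fun x => π.prob x s := π.measurable_prob.of_uncurry_right
  refine Integrable.add (Integrable.bdd_mul (c := 1)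
    ((hM.integrable_meanOutcome s true).add (integrable_const a)) hm.aestronglyMeasurable ?_)
    (Integrable.bdd_mul (c := 1) ((hM.integrable_meanOutcome s false).add (integrable_const b))
      (hm.const_sub 1).aestronglyMeasurable ?_)
  all_goals
    refine Eventually.of_forall fun x => ?_
    have := π.prob_nonneg x s
    have := π.prob_le_one x s
    rw [Real.norm_eq_abs, abs_le]
    constructor <;> linarith

-- The bound is uniform over policies, which is what compactness of the closure of achievable pairs
-- requires.
variable {M} in
theorem BoundedOutcomes.exists_bound_reward (hM : M.BoundedOutcomes) :
    ∃ B : ℝ, ∀ (π : TreatPolicy 𝒳 S) s, |M.reward π s| ≤ B := by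
  obtain ⟨B, hB⟩ := hM.exists_bound_meanOutcome
  refine ⟨B, fun π s => ?_⟩
  have h : ∀ᵐ x ∂M.PX, ‖π.prob x s * M.meanOutcome x s true
      + (1 - π.prob x s) * M.meanOutcome x s false‖ ≤ B := by
    filter_upwards [hB s true, hB s false] with x h1 h2
    have h3 := π.prob_nonneg x s
    have h4 := π.prob_le_one x s
    rw [abs_le] at h1 h2
    rw [Real.norm_eq_abs, abs_le]
    constructor <;> nlinarith
  simpa [reward] using norm_integral_le_of_norm_le_const h

variable {M} in
theorem BoundedOutcomes.expectedAverage_eq (hM : M.BoundedOutcomes) (s : S) (n : ℕ) :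
    M.expectedAverage π s n = (1 / (n : ℝ)) *
      ∑ i ∈ Finset.range n, ((M.stateMatrix π ^ i) *ᵥ M.reward π) s := by
  have hr (t : S) : ∫ r, r.2 ∂M.unitLaw π t = M.reward π t :=
    M.integral_unitLaw π measurable_snd (hM.integrable_unitLaw π t)
  have hint (i : ℕ) (t : S) : Integrable (fun r : UnitRecord 𝒳 S => r.2)
      (ENNReal.ofReal ((M.stateMatrix π ^ i) s t) • M.unitLaw π t) :=
    (hM.integrable_unitLaw π t).smul_measure ENNReal.ofReal_ne_top
  have hlaw (i : ℕ) : Integrable (fun r : UnitRecord 𝒳 S => r.2)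
      ((M.processLaw π s).map fun ω => ω i) := by
    rw [map_eval_processLaw]
    exact integrable_finsetSum_measure.2 fun t _ => hint i t
  have he (i : ℕ) : ∫ ω, outcome i ω ∂M.processLaw π s
      = ((M.stateMatrix π ^ i) *ᵥ M.reward π) s := by
    have hPi : M.stateMatrix π ^ i ∈ rowStochastic ℝ S :=
      pow_mem (M.stateMatrix_mem_rowStochastic π) i
    have h1 := integral_map (μ := M.processLaw π s) (φ := fun ω => ω i)
      (f := fun r : UnitRecord 𝒳 S => r.2) (measurable_pi_apply i).aemeasurable measurable_snd.aestronglyMeasurable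
    refine h1.symm.trans ?_
    rw [map_eval_processLaw, integral_finsetSum_measure fun t _ => hint i t]
    refine Finset.sum_congr rfl fun t _ => ?_
    rw [integral_smul_measure, hr, ENNReal.toReal_ofReal (nonneg_of_mem_rowStochastic hPi),
      smul_eq_mul]
  unfold expectedAverage
  rw [integral_const_mul, integral_finsetSum _ fun i _ => ?_]
  · simp_rw [he]
  · exact (hlaw i).comp_measurable (measurable_pi_apply i)

end ExogMDP

/-! ### Gain maximization and the greedy threshold policy. -/

namespace ExogMDP

open Matrix

variable {𝒳 S : Type*} [MeasurableSpace 𝒳] [Fintype S] [DecidableEq S] [MeasurableSpace S]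
  [MeasurableSingletonClass S] (M : ExogMDP 𝒳 S)

variable {M} in
theorem hasLongRunAverage_of_poisson (hM : M.BoundedOutcomes) {π : TreatPolicy 𝒳 S} {h : S → ℝ}
    {g : ℝ} (hg : ∀ s, g + h s = M.reward π s + (M.stateMatrix π *ᵥ h) s) :
    M.HasLongRunAverage π g := fun s => by
  have := tendsto_average_of_poisson (M.stateMatrix_mem_rowStochastic π) hg s
  exact this.congr fun n => (hM.expectedAverage_eq π s n).symm

/-- The solution of the Poisson equation with treatment probabilities `e` and rewards `r`. -/
noncomputable def poissonSolution (s₀ : S) (e r : S → ℝ) : S → ℝ :=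
  (poissonMatrix s₀ (M.mixMatrix e))⁻¹ *ᵥ r

variable {M} in
theorem IsStable.poissonSolution_spec (hM : M.IsStable) (s₀ : S) {e : S → ℝ}
    (he : ∀ s, e s ∈ Set.Icc (0 : ℝ) 1) (r : S → ℝ) (s : S) :
    M.poissonSolution s₀ e r s₀ + M.poissonSolution s₀ e r s =
      r s + (M.mixMatrix e *ᵥ M.poissonSolution s₀ e r) s := by
  have hu := isUnit_det_poissonMatrix s₀ (M.mixMatrix_mem_rowStochastic he)
    (hM.isIrreducible_mixMatrix he)
  have h : poissonMatrix s₀ (M.mixMatrix e) *ᵥ M.poissonSolution s₀ e r = r := by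
    rw [poissonSolution, mulVec_mulVec, mul_nonsing_inv _ hu, one_mulVec]
  have := congrFun h s
  rw [poissonMatrix_mulVec] at this
  linarith

-- By Cramer's rule the inverse is the adjugate divided by a determinant that does not vanish for
-- treatment probabilities in [0, 1].
variable {M} in
theorem IsStable.continuousOn_poissonSolution (hM : M.IsStable) (s₀ : S) :
    ContinuousOn (fun q : (S → ℝ) × (S → ℝ) => M.poissonSolution s₀ q.1 q.2)
      {q | ∀ s, q.1 s ∈ Set.Icc (0 : ℝ) 1} := by
  have hA : Continuous fun q : (S → ℝ) × (S → ℝ) => poissonMatrix s₀ (M.mixMatrix q.1) :=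
    (continuous_poissonMatrix s₀).comp (M.continuous_mixMatrix.comp continuous_fst)
  intro q hq
  have hu := isUnit_det_poissonMatrix s₀ (M.mixMatrix_mem_rowStochastic hq)
    (hM.isIrreducible_mixMatrix hq)
  refine ContinuousAt.continuousWithinAt ?_
  have hfun : (fun q : (S → ℝ) × (S → ℝ) => M.poissonSolution s₀ q.1 q.2) = fun q =>
      ((poissonMatrix s₀ (M.mixMatrix q.1)).det⁻¹ •
        (poissonMatrix s₀ (M.mixMatrix q.1)).adjugate) *ᵥ q.2 := by
    ext q : 1
    rw [poissonSolution, inv_def, Ring.inverse_eq_inv']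
  have hinv : ContinuousAt (fun q : (S → ℝ) × (S → ℝ) =>
      (poissonMatrix s₀ (M.mixMatrix q.1)).det⁻¹ •
        (poissonMatrix s₀ (M.mixMatrix q.1)).adjugate) q :=
    (hA.matrix_det.continuousAt.inv₀ hu.ne_zero).smul hA.matrix_adjugate.continuousAt
  rw [hfun, continuousAt_pi]
  intro s
  simp only [mulVec, dotProduct]
  refine tendsto_finsetSum _ fun j _ => ContinuousAt.mul ?_ ?_
  · exact continuousAt_pi.1 (continuousAt_pi.1 hinv s) j
  · exact ((continuous_apply j).comp continuous_snd).continuousAt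

theorem measurable_cade (s : S) : Measurable fun x => M.cade x s :=
  (M.measurable_meanOutcome s true).sub (M.measurable_meanOutcome s false)

/-- The policy that treats in state `s` exactly when the direct effect exceeds `c s`. -/
noncomputable def thresholdPolicy (c : S → ℝ) : TreatPolicy 𝒳 S where
  prob x s := if M.cade x s > c s then 1 else 0
  measurable_prob := measurable_from_prod_countable_left fun s =>
    Measurable.ite (measurableSet_lt (f := fun _ => c s) measurable_const (M.measurable_cade s))
      measurable_const measurable_const
  prob_nonneg x s := by split_ifs <;> norm_num
  prob_le_one x s := by split_ifs <;> norm_num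

variable {M} in
theorem BoundedOutcomes.reward_add_mulVec (hM : M.BoundedOutcomes) (π : TreatPolicy 𝒳 S)
    (h : S → ℝ) (s : S) :
    M.reward π s + (M.stateMatrix π *ᵥ h) s =
      ∫ x, (π.prob x s * (M.meanOutcome x s true + ∑ s', (M.PS (s, true)).real {s'} * h s')
        + (1 - π.prob x s) *
          (M.meanOutcome x s false + ∑ s', (M.PS (s, false)).real {s'} * h s')) ∂M.PX := by
  have hi := M.integrable_prob π s
  have hi' : Integrable (fun x => 1 - π.prob x s) M.PX := (integrable_const 1).sub hi
  have h1 : (M.stateMatrix π *ᵥ h) s =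
      ∫ x, (π.prob x s * (∑ s', (M.PS (s, true)).real {s'} * h s')
        + (1 - π.prob x s) * (∑ s', (M.PS (s, false)).real {s'} * h s')) ∂M.PX := by
    rw [integral_add (hi.mul_const _) (hi'.mul_const _), integral_mul_const, integral_mul_const,
      integral_sub (integrable_const 1) hi, stateMatrix_eq_mixMatrix]
    simp only [mulVec, dotProduct, mixMatrix, add_mul, Finset.sum_add_distrib, mul_assoc,
      ← Finset.mul_sum]
    simp
  have h2 := hM.integrable_prob_mul_add π s 0 0
  simp only [add_zero] at h2
  rw [h1, reward, ← integral_add h2 (by exact (hi.mul_const _).add (hi'.mul_const _))]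
  exact integral_congr_ae (Eventually.of_forall fun x => by ring)

/-- The threshold policy is greedy with respect to the relative value function `h`. -/
theorem BoundedOutcomes.reward_add_mulVec_le {M : ExogMDP 𝒳 S} (hM : M.BoundedOutcomes)
    (π : TreatPolicy 𝒳 S) (h : S → ℝ) (s : S) :
    let c : S → ℝ := fun s => (∑ s', (M.PS (s, false)).real {s'} * h s')
      - ∑ s', (M.PS (s, true)).real {s'} * h s'
    M.reward π s + (M.stateMatrix π *ᵥ h) s ≤
      M.reward (M.thresholdPolicy c) s + (M.stateMatrix (M.thresholdPolicy c) *ᵥ h) s := by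
  intro c
  rw [hM.reward_add_mulVec, hM.reward_add_mulVec]
  refine integral_mono (hM.integrable_prob_mul_add _ _ _ _) (hM.integrable_prob_mul_add _ _ _ _)
    fun x => ?_
  have h0 := π.prob_nonneg x s
  have h1 := π.prob_le_one x s
  have hc : c s = (∑ s', (M.PS (s, false)).real {s'} * h s')
    - ∑ s', (M.PS (s, true)).real {s'} * h s' := rfl
  have ht : M.cade x s = M.meanOutcome x s true - M.meanOutcome x s false := rfl
  simp only [thresholdPolicy]
  -- The two integrands differ by (π'(x, s) - π(x, s)) (τ(x, s) - c(s)), where π' is the threshold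
  -- policy; both factors have the same sign, or the product is zero.
  split_ifs with hx <;> nlinarith

theorem exists_isOptimal_thresholdPolicy [Nonempty S] (hstable : M.IsStable)
    (hbdd : M.BoundedOutcomes) : ∃ c : S → ℝ, M.IsOptimal (M.thresholdPolicy c) := by
  obtain ⟨s₀⟩ := ‹Nonempty S›
  set eff : TreatPolicy 𝒳 S → S → ℝ := fun π s => ∫ x, π.prob x s ∂M.PX
  have heff (π : TreatPolicy 𝒳 S) : ∀ s, eff π s ∈ Set.Icc (0 : ℝ) 1 := M.integral_prob_mem_Icc π
  have hstate (π : TreatPolicy 𝒳 S) : M.stateMatrix π = M.mixMatrix (eff π) :=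
    M.stateMatrix_eq_mixMatrix π
  have hLRA (π : TreatPolicy 𝒳 S) :
      M.HasLongRunAverage π (M.poissonSolution s₀ (eff π) (M.reward π) s₀) :=
    hasLongRunAverage_of_poisson hbdd fun s => by
      rw [hstate]; exact hstable.poissonSolution_spec s₀ (heff π) _ s
  set D : Set ((S → ℝ) × (S → ℝ)) := {q | ∀ s, q.1 s ∈ Set.Icc (0 : ℝ) 1}
  set K := closure (Set.range fun π : TreatPolicy 𝒳 S => (eff π, M.reward π)) with hK
  obtain ⟨B, hB⟩ := hbdd.exists_bound_reward
  have hbox : IsCompact ((Set.univ.pi fun _ : S => Set.Icc (0 : ℝ) 1) ×ˢ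
      (Set.univ.pi fun _ : S => Set.Icc (-B) B)) :=
    (isCompact_univ_pi fun _ => isCompact_Icc).prod (isCompact_univ_pi fun _ => isCompact_Icc)
  have hKbox : K ⊆ (Set.univ.pi fun _ : S => Set.Icc (0 : ℝ) 1) ×ˢ
      (Set.univ.pi fun _ : S => Set.Icc (-B) B) := by
    refine closure_minimal ?_ hbox.isClosed
    rintro _ ⟨π, rfl⟩
    exact ⟨fun s _ => heff π s, fun s _ => abs_le.1 (hB π s)⟩
  have hKc : IsCompact K := hbox.of_isClosed_subset isClosed_closure hKbox
  have hKD : K ⊆ D := fun q hq s => (hKbox hq).1 s trivial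
  have hcont : ContinuousOn (fun q : (S → ℝ) × (S → ℝ) => M.poissonSolution s₀ q.1 q.2 s₀) K :=
    (continuousOn_pi.1 (hstable.continuousOn_poissonSolution s₀) s₀).mono hKD
  have hmem (π : TreatPolicy 𝒳 S) : (eff π, M.reward π) ∈ K := subset_closure ⟨π, rfl⟩
  -- The threshold policy at 0 only witnesses that `K` is nonempty. The maximizer is a limit of
  -- achievable pairs and need not itself be achievable.
  obtain ⟨⟨e, r⟩, hq, hmax⟩ := hKc.exists_isMaxOn
    ⟨_, hmem (M.thresholdPolicy 0)⟩ hcont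
  set h := M.poissonSolution s₀ e r with hh
  set c : S → ℝ := fun s => (∑ s', (M.PS (s, false)).real {s'} * h s')
      - ∑ s', (M.PS (s, true)).real {s'} * h s'
  set π' := M.thresholdPolicy c
  -- Greediness is a non-strict inequality, continuous in the pair, so it passes from achievable
  -- pairs to their closure and covers the maximizer.
  have hgreedy : ∀ q ∈ K, ∀ s, q.2 s + (M.mixMatrix q.1 *ᵥ h) s ≤
      M.reward π' s + (M.stateMatrix π' *ᵥ h) s := by
    intro q hqK s
    have hcl : IsClosed {q : (S → ℝ) × (S → ℝ) | q.2 s + (M.mixMatrix q.1 *ᵥ h) s ≤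
        M.reward π' s + (M.stateMatrix π' *ᵥ h) s} := by
      refine isClosed_le ?_ continuous_const
      have : Continuous fun q : (S → ℝ) × (S → ℝ) => M.mixMatrix q.1 *ᵥ h :=
        (M.continuous_mixMatrix.comp continuous_fst).matrix_mulVec continuous_const
      exact ((continuous_apply s).comp continuous_snd).add ((continuous_apply s).comp this)
    refine closure_minimal ?_ hcl hqK
    rintro _ ⟨π, rfl⟩
    simp only [Set.mem_ofPred_eq]
    rw [← hstate]
    exact hbdd.reward_add_mulVec_le π h s
  set h' := M.poissonSolution s₀ (eff π') (M.reward π') with hh'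
  have hge : h s₀ ≤ h' s₀ := by
    have : Nonempty S := ⟨s₀⟩
    -- Subtracting the two Poisson equations at `m` and using greediness gives g' - g + (h' - h)(m)
    -- ≥ (P'(h' - h))(m) ≥ (h' - h)(m), where g = h(s₀) and g' = h'(s₀).
    obtain ⟨m, hm⟩ := Finite.exists_min (h' - h)
    have h1 := hstable.poissonSolution_spec s₀ (hKD hq) r m
    have h2 := hstable.poissonSolution_spec s₀ (heff π') (M.reward π') m
    have h3 := hgreedy _ hq m
    have h4 := le_mulVec_of_mem_rowStochastic (M.stateMatrix_mem_rowStochastic π') hm m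
    rw [mulVec_sub, Pi.sub_apply, Pi.sub_apply] at h4
    rw [← hstate] at h2
    simp only [← hh] at h1
    simp only [← hh'] at h2
    linarith
  exact ⟨c, h' s₀, hLRA π', fun π => ⟨_, hLRA π, (hmax (hmem π)).trans hge⟩⟩

end ExogMDP

theorem theorem1 {𝒳 S : Type*} [MeasurableSpace 𝒳] [Fintype S] [Nonempty S] [DecidableEq S]
    [MeasurableSpace S] [MeasurableSingletonClass S] (M : ExogMDP 𝒳 S)
    (hstable : M.IsStable) (hbdd : M.BoundedOutcomes) :
    (∃ π : TreatPolicy 𝒳 S, M.IsOptimal π ∧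
      ∃ c p : S → ℝ, (∀ s, p s ∈ Set.Icc (0 : ℝ) 1) ∧
        ∀ x s, π.prob x s =
          (if M.cade x s > c s then 1 else 0) + (if M.cade x s = c s then 1 else 0) * p s) ∧
    ((∀ s, ∀ t : ℝ, M.PX {x | M.cade x s = t} = 0) →
      ∃ π : TreatPolicy 𝒳 S, M.IsOptimal π ∧
        ∃ c : S → ℝ, ∀ x s, π.prob x s = if M.cade x s > c s then 1 else 0) := by
  obtain ⟨c, hc⟩ := M.exists_isOptimal_thresholdPolicy hstable hbdd
  -- Ties τ = c contribute equally under either treatment, so never treating them, p = 0, is a valid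
  -- choice.
  exact ⟨⟨_, hc, c, 0, fun s => ⟨le_rfl, zero_le_one⟩, fun x s => by
    simp [ExogMDP.thresholdPolicy]⟩, fun _ => ⟨_, hc, c, fun x s => rfl⟩⟩
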